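/- Consider the planar cubic system $$\dot x = xy-x^2y,\qquad \dot y = y^2+\tfrac14x^3+\tfrac14x^2+\tfrac14x+\tfrac14,$$ with first integral $H(x,y)=\frac1{16}x^{-2}(x-1)^2(x^2+2x+1+4y^2)$ and centre $(-1,0)$. For $h>0$ let $\Gamma_h=\{(x,y): x<0,\ H(x,y)=h\}$. Each $\Gamma_h$ is a closed orbit of the system surrounding $(-1,0)$; orient it by the flow. Let $n\ge 3$, let $a_0,\dots,a_n\in\mathbb R$, and put $$I(h)=\frac12\sum_{i=0}^n a_i\oint_{\Gamma_h}(x-1)x^{i-3}y\,dx,\qquad h\in(0,+\infty).$$ Let $$K(k)=\int_0^{\pi/2}\frac{d\theta}{\sqrt{1-k^2\sin^2\theta}},\qquad E(k)=\int_0^{\pi/2}\sqrt{1-k^2\sin^2\theta}\,d\theta$$ be the complete elliptic integrals of the first and second kind, and set $$u=\sqrt{8h+1-4\sqrt{4h^2+h}},\qquad k=\sqrt{1-u^4}.$$ Then $h\mapsto u$ is a bijection from $(0,+\infty)$ onto $(0,1)$, and, with $[\cdot]$ denoting the integer part, there are real polynomials $P,Q,R$ (depending only on $n$ and $a_0,\dots,a_n$)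 such that for all $h>0$: - if $n$ is odd, $$I(h)=\frac{1}{u^{2[\frac{n-3}{2}]+3}}\Big[u\,P(u^2)+Q(u)K(k)+R(u^2)E(k)\Big],$$ with $\deg P\le 2[\frac{n-2}2]+2$, $\deg Q\le 4[\frac{n-3}2]+6$, $\deg R\le 2[\frac{n-3}2]+2$; - if $n$ is even, $$I(h)=\frac{1}{u^{2[\frac{n-2}{2}]+2}}\Big[P(u^2)+Q(u)K(k)+u\,R(u^2)E(k)\Big],$$ with $\deg P\le 2[\frac{n-2}2]+2$, $\deg Q\le 4[\frac{n-3}2]+7$, $\deg R\le 2[\frac{n-3}2]+2$. -/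

import Mathlib

namespace CubicReversible

noncomputable section

/-- The unperturbed system `x' = x y - x² y`, `y' = y² + x³/4 + x²/4 + x/4 + 1/4`. -/
def vectorField (p : ℝ × ℝ) : ℝ × ℝ :=
  (p.1 * p.2 - p.1 ^ 2 * p.2,
    p.2 ^ 2 + (1 / 4) * p.1 ^ 3 + (1 / 4) * p.1 ^ 2 + (1 / 4) * p.1 + 1 / 4)

/-- The first integral `H(x, y) = (1/16) x⁻² (x - 1)² (x² + 2x + 1 + 4y²)`, used for `x < 0`. -/
def firstIntegral (p : ℝ × ℝ) : ℝ :=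
  (1 / 16) * (p.1 ^ 2)⁻¹ * (p.1 - 1) ^ 2 * (p.1 ^ 2 + 2 * p.1 + 1 + 4 * p.2 ^ 2)

/-- The oval `Γ_h` around the centre `(-1, 0)`. The level set of `H` at level `h` also has points
with `x > 0`, which do not surround the centre; the oval is its part in the half plane `x < 0`. -/
def oval (h : ℝ) : Set (ℝ × ℝ) :=
  {p | p.1 < 0 ∧ firstIntegral p = h}

/-- `γ` is a periodic solution of the unperturbed system, of period `T`, which runs through `Γ_h`
exactly once per period: a parametrization of the closed orbit `Γ_h`, oriented by the flow. -/
structure IsOrbitParam (h : ℝ) (γ : ℝ → ℝ × ℝ) (T : ℝ) : Prop where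
  period_pos : 0 < T
  solution : ∀ t, HasDerivAt γ (vectorField (γ t)) t
  periodic : Function.Periodic γ T
  bijOn : Set.BijOn γ (Set.Ico 0 T) (oval h)

/-- The line integral `∮ (x - 1) x^(i - 3) y^j dx` along the closed curve `γ` on `[0, T]`. -/
def lineIntegral (γ : ℝ → ℝ × ℝ) (T : ℝ) (i j : ℕ) : ℝ :=
  ∫ t in (0 : ℝ)..T,
    ((γ t).1 - 1) * (γ t).1 ^ ((i : ℤ) - 3) * (γ t).2 ^ j * deriv (fun s => (γ s).1) t

/-- The Abelian integral `(1/2) ∑_{i=0}^n a_i ∮ (x - 1) x^(i - 3) y dx` along `γ`. -/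
def abelianIntegral (n : ℕ) (a : ℕ → ℝ) (γ : ℝ → ℝ × ℝ) (T : ℝ) : ℝ :=
  (1 / 2) * ∑ i ∈ Finset.range (n + 1), a i * lineIntegral γ T i 1

/-- The complete elliptic integral of the first kind with modulus `k`. -/
def ellipticK (k : ℝ) : ℝ :=
  ∫ θ in (0 : ℝ)..(Real.pi / 2), 1 / √(1 - k ^ 2 * Real.sin θ ^ 2)

/-- The complete elliptic integral of the second kind with modulus `k`. -/
def ellipticE (k : ℝ) : ℝ :=
  ∫ θ in (0 : ℝ)..(Real.pi / 2), √(1 - k ^ 2 * Real.sin θ ^ 2)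

/-- The new variable `u` as a function of `h`. -/
def uVar (h : ℝ) : ℝ := √(8 * h + 1 - 4 * √(4 * h ^ 2 + h))

/-- The modulus `k = √(1 - u⁴)`. -/
def modulus (u : ℝ) : ℝ := √(1 - u ^ 4)

end

end CubicReversible

namespace CubicReversible

/-! Along the flow put `p = x⁻²` and `r = p' = -2y(1 - x)/x²`. The equation `H = h` becomes the
circle `(p - A)² + r² = B²`, where `A = 8h + 1` and `B² = A² - 1`, and there `r' = A - p`. The
centre is therefore isochronous: every orbit parametrization has period `2π` and is a time shift of
the explicit one with `p = A - B cos t` (`IsOrbitParam.eq_explicitOrbit`). With `s = -x = p^(-1/2)`,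
each line integral is a combination of three moments `J_i = ∫ s^i dt` over a period
(`lineIntegral_eq`). The moments satisfy a three-term recurrence (`powIntegral_recurrence`), which
separates the parities. For even `i` everything reduces to `J_2 = 2π`; for odd `i` to `J_1 = 4uK`
and `J_3 = J_{-1} = 4E/u`. Finally `u² = A - B` and `(A - B)(A + B) = 1` give `u²A = (u⁴ + 1)/2`.
Each step of the recurrence thus costs a factor `u²` and raises the coefficient degrees in `u⁴` by
one (`QuarticForm.comb`). Multiplying the line integrals by the common factor `uⁿ` and counting
degrees gives the result. -/

theorem exists_angle {a b : ℝ} (hab : a ^ 2 + b ^ 2 = 1) :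
    ∃ t ∈ Set.Ico 0 (2 * Real.pi), Real.cos t = a ∧ Real.sin t = b := by
  have hn : ‖(⟨a, b⟩ : ℂ)‖ = 1 := by
    rw [Complex.norm_def, Complex.normSq_mk, ← sq, ← sq, hab, Real.sqrt_one]
  have h0 : (⟨a, b⟩ : ℂ) ≠ 0 := by
    intro h
    simp [h] at hn
  have hc := Complex.cos_arg h0
  have hs := Complex.sin_arg (⟨a, b⟩ : ℂ)
  rw [hn] at hc hs
  simp only [div_one] at hc hs
  refine ⟨toIcoMod Real.two_pi_pos 0 (Complex.arg ⟨a, b⟩), ?_, ?_, ?_⟩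
  · simpa using toIcoMod_mem_Ico Real.two_pi_pos 0 (Complex.arg ⟨a, b⟩)
  · rw [toIcoMod, zsmul_eq_mul, Real.cos_sub_int_mul_two_pi, hc]
  · rw [toIcoMod, zsmul_eq_mul, Real.sin_sub_int_mul_two_pi, hs]

theorem eq_of_cos_eq_sin_eq {s t : ℝ} (hs : s ∈ Set.Ico 0 (2 * Real.pi))
    (ht : t ∈ Set.Ico 0 (2 * Real.pi)) (hc : Real.cos s = Real.cos t)
    (hsin : Real.sin s = Real.sin t) : s = t := by
  have h := Real.Angle.cos_sin_inj hc hsin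
  obtain ⟨k, hk⟩ := Real.Angle.angle_eq_iff_two_pi_dvd_sub.1 h
  have hk0 : k = 0 := by
    have h1 : (k : ℝ) < 1 := by nlinarith [hs.1, hs.2, ht.1, ht.2, Real.pi_pos]
    have h2 : (-1 : ℝ) < k := by nlinarith [hs.1, hs.2, ht.1, ht.2, Real.pi_pos]
    have h1' : k < 1 := by exact_mod_cast h1
    have h2' : -1 < k := by exact_mod_cast h2
    omega
  simp [hk0] at hk
  linarith

/-! ### The explicit orbit. -/

/-- Half the sum of the squared extreme abscissae of the oval at level `h`. -/
noncomputable def ovalMean (h : ℝ) : ℝ := 8 * h + 1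

/-- Half the difference of the squared extreme abscissae of the oval at level `h`. -/
noncomputable def ovalAmp (h : ℝ) : ℝ := 4 * √(4 * h ^ 2 + h)

theorem ovalAmp_pos {h : ℝ} (hh : 0 < h) : 0 < ovalAmp h := by
  unfold ovalAmp; positivity

theorem ovalAmp_sq {h : ℝ} (hh : 0 < h) : ovalAmp h ^ 2 = ovalMean h ^ 2 - 1 := by
  unfold ovalAmp ovalMean
  rw [mul_pow, Real.sq_sqrt (by positivity)]; ring

theorem ovalAmp_lt {h : ℝ} (hh : 0 < h) : ovalAmp h < ovalMean h := by
  have h1 : 0 < ovalMean h := by unfold ovalMean; positivity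
  nlinarith [ovalAmp_sq hh, ovalAmp_pos hh]

/-- The squared reciprocal abscissa along the orbit, in terms of its mean and amplitude. -/
noncomputable def recipSq (A B t : ℝ) : ℝ := A - B * Real.cos t

theorem recipSq_pos {A B : ℝ} (hB : 0 < B) (hAB : B < A) (t : ℝ) : 0 < recipSq A B t := by
  unfold recipSq
  nlinarith [Real.cos_le_one t]

/-- Minus the abscissa along the orbit. -/
noncomputable def absc (A B t : ℝ) : ℝ := 1 / √(recipSq A B t)

theorem absc_pos {A B : ℝ} (hB : 0 < B) (hAB : B < A) (t : ℝ) : 0 < absc A B t :=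
  one_div_pos.2 (Real.sqrt_pos.2 (recipSq_pos hB hAB t))

theorem recipSq_mul_absc_sq {A B : ℝ} (hB : 0 < B) (hAB : B < A) (t : ℝ) :
    recipSq A B t * absc A B t ^ 2 = 1 := by
  have := recipSq_pos hB hAB t
  rw [absc, div_pow, Real.sq_sqrt this.le]
  field_simp

theorem hasDerivAt_recipSq (A B t : ℝ) :
    HasDerivAt (recipSq A B) (B * Real.sin t) t := by
  exact (((Real.hasDerivAt_cos t).const_mul B).const_sub A).congr_deriv (by ring)

theorem hasDerivAt_absc {A B : ℝ} (hB : 0 < B) (hAB : B < A) (t : ℝ) :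
    HasDerivAt (absc A B) (-(1 / 2) * absc A B t ^ 3 * (B * Real.sin t)) t := by
  have hp := recipSq_pos hB hAB t
  have := ((hasDerivAt_recipSq A B t).sqrt hp.ne').inv (Real.sqrt_pos.2 hp).ne'
  have e : absc A B = (fun y => √(recipSq A B y))⁻¹ := by
    funext y; simp [absc]
  refine (e ▸ this).congr_deriv ?_
  have hs := Real.sqrt_pos.2 hp
  rw [show absc A B t = 1 / √(recipSq A B t) from rfl]
  field_simp

theorem continuous_absc {A B : ℝ} (hB : 0 < B) (hAB : B < A) : Continuous (absc A B) :=
  continuous_iff_continuousAt.2 fun t => (hasDerivAt_absc hB hAB t).continuousAt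

theorem absc_add_two_pi (A B t : ℝ) : absc A B (t + 2 * Real.pi) = absc A B t := by
  simp [absc, recipSq]

/-- The orbit of level `h` with its explicit time parametrization. -/
noncomputable def explicitOrbit (h t : ℝ) : ℝ × ℝ :=
  let s := absc (ovalMean h) (ovalAmp h) t
  (-s, -(ovalAmp h * Real.sin t * s ^ 2) / (2 * (1 + s)))

/-- The ordinate was chosen by solving `-2y(1 - x)/x² = B sin t` for `y`, so the first component
holds by construction. The second one uses `A² - B² = 1`. -/
theorem hasDerivAt_explicitOrbit {h : ℝ} (hh : 0 < h) (t : ℝ) :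
    HasDerivAt (explicitOrbit h) (vectorField (explicitOrbit h t)) t := by
  have hB := ovalAmp_pos hh
  have hAB := ovalAmp_lt hh
  have hsq := ovalAmp_sq hh
  set A := ovalMean h
  set B := ovalAmp h
  have hs := hasDerivAt_absc hB hAB t
  have hs0 := absc_pos hB hAB t
  have hps := recipSq_mul_absc_sq hB hAB t
  have hden : HasDerivAt (fun t => 2 * (1 + absc A B t))
      (2 * (-(1 / 2) * absc A B t ^ 3 * (B * Real.sin t))) t := (hs.const_add 1).const_mul 2
  have hnum : HasDerivAt (fun t => -(B * Real.sin t * absc A B t ^ 2))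
      (-(B * Real.cos t * absc A B t ^ 2 + B * Real.sin t *
        (2 * absc A B t * (-(1 / 2) * absc A B t ^ 3 * (B * Real.sin t))))) t := by
    refine (((Real.hasDerivAt_sin t).const_mul B).mul (hs.pow 2)).neg.congr_deriv ?_
    simp only [Pi.pow_apply]
    push_cast
    ring
  have hy := hnum.div hden (by positivity)
  refine (hs.neg.prodMk hy).congr_deriv ?_
  unfold vectorField explicitOrbit
  simp only
  have hc : B * Real.cos t * absc A B t ^ 2 = A * absc A B t ^ 2 - 1 := by
    unfold recipSq at hps; linarith
  have hr : (B * Real.sin t) ^ 2 * absc A B t ^ 4 =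
      -absc A B t ^ 4 + 2 * A * absc A B t ^ 2 - 1 := by
    have : (B * Real.sin t) ^ 2 * absc A B t ^ 4 =
      B ^ 2 * absc A B t ^ 4 - (B * Real.cos t * absc A B t ^ 2) ^ 2 := by
      linear_combination (B ^ 2 * absc A B t ^ 4) * Real.sin_sq_add_cos_sq t
    rw [this, hc, hsq]; ring
  rw [hc]
  generalize B * Real.sin t = r at *
  change 0 < absc A B t at hs0
  change (_, _) = (_, _)
  generalize absc A B t = s at *
  refine Prod.ext ?_ ?_
  · simp only
    field_simp
    ring
  · simp only
    field_simp
    linear_combination (1+s) * 4 * hr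

/-! ### Oscillator coordinates on the ovals. -/

/-- The squared reciprocal abscissa and its time derivative: along the flow on an oval these
coordinates perform a harmonic oscillation. -/
noncomputable def oscCoord (p : ℝ × ℝ) : ℝ × ℝ :=
  ((p.1 ^ 2)⁻¹, -(2 * p.2 * (1 - p.1) / p.1 ^ 2))

/-- In these coordinates `8H + 1 = (p² + r² + 1)/(2p)`, so level sets are circles centred at `(8h +
1, 0)`. -/
theorem mem_oval_iff {h : ℝ} {p : ℝ × ℝ} (hx : p.1 < 0) :
    p ∈ oval h ↔
      ((oscCoord p).1 - ovalMean h) ^ 2 + (oscCoord p).2 ^ 2 = ovalMean h ^ 2 - 1 := by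
  obtain ⟨x, y⟩ := p
  simp only [oval, firstIntegral, Set.mem_ofPred_eq, oscCoord, ovalMean] at hx ⊢
  have hx0 := hx.ne
  constructor
  · rintro ⟨-, h1⟩
    field_simp at h1 ⊢
    linear_combination h1
  · intro h1
    refine ⟨hx, ?_⟩
    field_simp at h1 ⊢
    linear_combination h1

theorem oscCoord_injOn {p q : ℝ × ℝ} (hp : p.1 < 0) (hq : q.1 < 0)
    (hpq : oscCoord p = oscCoord q) : p = q := by
  obtain ⟨x, y⟩ := p
  obtain ⟨x', y'⟩ := q
  simp only [oscCoord, Prod.mk.injEq, inv_inj] at hp hq hpq ⊢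
  obtain ⟨h1, h2⟩ := hpq
  have hxx : x = x' := by
    rcases sq_eq_sq_iff_eq_or_eq_neg.1 h1 with h | h
    · exact h
    · linarith
  subst hxx
  refine ⟨rfl, ?_⟩
  have hx0 := hp.ne
  have hx1 : (1 - x) ≠ 0 := by linarith
  field_simp at h2
  linarith

theorem explicitOrbit_fst_neg {h : ℝ} (hh : 0 < h) (t : ℝ) : (explicitOrbit h t).1 < 0 :=
  neg_neg_of_pos (absc_pos (ovalAmp_pos hh) (ovalAmp_lt hh) t)

theorem oscCoord_explicitOrbit {h : ℝ} (hh : 0 < h) (t : ℝ) :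
    oscCoord (explicitOrbit h t) =
      (ovalMean h - ovalAmp h * Real.cos t, ovalAmp h * Real.sin t) := by
  have hps := recipSq_mul_absc_sq (ovalAmp_pos hh) (ovalAmp_lt hh) t
  have hs := absc_pos (ovalAmp_pos hh) (ovalAmp_lt hh) t
  unfold oscCoord explicitOrbit
  simp only
  unfold recipSq at hps
  generalize absc (ovalMean h) (ovalAmp h) t = s at *
  refine Prod.ext ?_ ?_
  · simp only
    field_simp
    linarith
  · simp only
    have : 1 - -s = 1 + s := by ring
    rw [this]
    field_simp

theorem explicitOrbit_mem_oval {h : ℝ} (hh : 0 < h) (t : ℝ) : explicitOrbit h t ∈ oval h := by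
  rw [mem_oval_iff (explicitOrbit_fst_neg hh t), oscCoord_explicitOrbit hh, ← ovalAmp_sq hh]
  simp only
  linear_combination ovalAmp h ^ 2 * Real.sin_sq_add_cos_sq t

theorem explicitOrbit_periodic (h : ℝ) : Function.Periodic (explicitOrbit h) (2 * Real.pi) := by
  intro t
  simp [explicitOrbit, absc_add_two_pi]

theorem explicitOrbit_eq_iff {h : ℝ} (hh : 0 < h) {s t : ℝ} :
    explicitOrbit h s = explicitOrbit h t ↔
      Real.cos s = Real.cos t ∧ Real.sin s = Real.sin t := by
  have hB := (ovalAmp_pos hh).ne'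
  constructor
  · intro e
    have := congrArg oscCoord e
    rw [oscCoord_explicitOrbit hh, oscCoord_explicitOrbit hh] at this
    simpa [hB] using this
  · rintro ⟨hc, hs⟩
    apply oscCoord_injOn (explicitOrbit_fst_neg hh s) (explicitOrbit_fst_neg hh t)
    rw [oscCoord_explicitOrbit hh, oscCoord_explicitOrbit hh, hc, hs]

theorem exists_explicitOrbit_eq {h : ℝ} (hh : 0 < h) {p : ℝ × ℝ} (hp : p ∈ oval h) :
    ∃ t ∈ Set.Ico 0 (2 * Real.pi), explicitOrbit h t = p := by
  have hB := (ovalAmp_pos hh).ne'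
  have h1 := (mem_oval_iff hp.1).1 hp
  rw [← ovalAmp_sq hh] at h1
  obtain ⟨t, ht, hc, hs⟩ := exists_angle
    (a := (ovalMean h - (oscCoord p).1) / ovalAmp h) (b := (oscCoord p).2 / ovalAmp h)
    (by field_simp; linarith)
  refine ⟨t, ht, oscCoord_injOn (explicitOrbit_fst_neg hh t) hp.1 ?_⟩
  rw [oscCoord_explicitOrbit hh, hc, hs]
  ext <;> simp only <;> field_simp
  ring

theorem isOrbitParam_explicitOrbit {h : ℝ} (hh : 0 < h) :
    IsOrbitParam h (explicitOrbit h) (2 * Real.pi) where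
  period_pos := Real.two_pi_pos
  solution := hasDerivAt_explicitOrbit hh
  periodic := explicitOrbit_periodic h
  bijOn := by
    refine ⟨fun t _ => explicitOrbit_mem_oval hh t, ?_, fun p hp => exists_explicitOrbit_eq hh hp⟩
    intro s hs t ht e
    obtain ⟨hc, hsin⟩ := (explicitOrbit_eq_iff hh).1 e
    exact eq_of_cos_eq_sin_eq hs ht hc hsin

/-! ### Every orbit parametrization is a shift of the explicit one. -/

/-- A solution of `p' = r`, `r' = A - p` is a harmonic oscillation about `A`. -/
theorem harmonic_solution {A : ℝ} {p r : ℝ → ℝ} (hp : ∀ t, HasDerivAt p (r t) t)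
    (hr : ∀ t, HasDerivAt r (A - p t) t) (t : ℝ) :
    p t = A + (p 0 - A) * Real.cos t + r 0 * Real.sin t ∧
      r t = r 0 * Real.cos t - (p 0 - A) * Real.sin t := by
  -- Rotating the phase vector `(p - A, r)` back by the angle `t` freezes it; these are its two
  -- components.
  have h1 : ∀ t, HasDerivAt (fun t => (p t - A) * Real.cos t - r t * Real.sin t) 0 t := by
    intro t
    refine ((((hp t).sub_const A).mul (Real.hasDerivAt_cos t)).sub
      ((hr t).mul (Real.hasDerivAt_sin t))).congr_deriv ?_
    ring
  have h2 : ∀ t, HasDerivAt (fun t => (p t - A) * Real.sin t + r t * Real.cos t) 0 t := by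
    intro t
    refine ((((hp t).sub_const A).mul (Real.hasDerivAt_sin t)).add
      ((hr t).mul (Real.hasDerivAt_cos t))).congr_deriv ?_
    ring
  have e1 := is_const_of_deriv_eq_zero (fun t => (h1 t).differentiableAt)
    (fun t => (h1 t).deriv) t 0
  have e2 := is_const_of_deriv_eq_zero (fun t => (h2 t).differentiableAt)
    (fun t => (h2 t).deriv) t 0
  simp only [Real.cos_zero, Real.sin_zero, mul_one, mul_zero, sub_zero, zero_add] at e1 e2
  have hsc := Real.sin_sq_add_cos_sq t
  constructor
  · linear_combination Real.cos t * e1 + Real.sin t * e2 - (p t - A) * hsc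
  · linear_combination Real.cos t * e2 - Real.sin t * e1 - r t * hsc

theorem IsOrbitParam.mem_oval {h : ℝ} {γ : ℝ → ℝ × ℝ} {T : ℝ} (H : IsOrbitParam h γ T) (t : ℝ) :
    γ t ∈ oval h := by
  obtain ⟨s, hs, e⟩ := H.periodic.exists_mem_Ico₀ H.period_pos t
  rw [e]
  exact H.bijOn.mapsTo hs

theorem IsOrbitParam.hasDerivAt_fst {h : ℝ} {γ : ℝ → ℝ × ℝ} {T : ℝ} (H : IsOrbitParam h γ T)
    (t : ℝ) : HasDerivAt (fun t => (γ t).1) ((γ t).1 * (γ t).2 - (γ t).1 ^ 2 * (γ t).2) t :=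
  (ContinuousLinearMap.fst ℝ ℝ ℝ).hasFDerivAt.comp_hasDerivAt t (H.solution t)

theorem IsOrbitParam.hasDerivAt_snd {h : ℝ} {γ : ℝ → ℝ × ℝ} {T : ℝ} (H : IsOrbitParam h γ T)
    (t : ℝ) : HasDerivAt (fun t => (γ t).2) ((γ t).2 ^ 2 + (1 / 4) * (γ t).1 ^ 3
      + (1 / 4) * (γ t).1 ^ 2 + (1 / 4) * (γ t).1 + 1 / 4) t :=
  (ContinuousLinearMap.snd ℝ ℝ ℝ).hasFDerivAt.comp_hasDerivAt t (H.solution t)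

theorem IsOrbitParam.hasDerivAt_oscCoord_fst {h : ℝ} {γ : ℝ → ℝ × ℝ} {T : ℝ}
    (H : IsOrbitParam h γ T) (t : ℝ) :
    HasDerivAt (fun t => (oscCoord (γ t)).1) (oscCoord (γ t)).2 t := by
  have hx0 := (H.mem_oval t).1.ne
  refine (((H.hasDerivAt_fst t).pow 2).inv (pow_ne_zero 2 hx0)).congr_deriv ?_
  simp only [oscCoord, Pi.pow_apply]
  field_simp
  push_cast
  ring

theorem IsOrbitParam.hasDerivAt_oscCoord_snd {h : ℝ} {γ : ℝ → ℝ × ℝ} {T : ℝ}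
    (H : IsOrbitParam h γ T) (t : ℝ) :
    HasDerivAt (fun t => (oscCoord (γ t)).2) (ovalMean h - (oscCoord (γ t)).1) t := by
  obtain ⟨hx, hE⟩ := H.mem_oval t
  have hx0 := hx.ne
  refine ((((H.hasDerivAt_snd t).const_mul 2).mul ((H.hasDerivAt_fst t).const_sub 1)).div
    ((H.hasDerivAt_fst t).pow 2) (pow_ne_zero 2 hx0)).neg.congr_deriv ?_
  simp only [oscCoord, Pi.pow_apply, Pi.mul_apply, ovalMean]
  rw [← hE, firstIntegral]
  field_simp
  push_cast
  ring

theorem IsOrbitParam.eq_explicitOrbit {h : ℝ} (hh : 0 < h) {γ : ℝ → ℝ × ℝ} {T : ℝ}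
    (H : IsOrbitParam h γ T) :
    T = 2 * Real.pi ∧ ∃ t₀, ∀ t, γ t = explicitOrbit h (t + t₀) := by
  obtain ⟨t₀, -, ht₀⟩ := exists_explicitOrbit_eq hh (H.mem_oval 0)
  have key : ∀ t, γ t = explicitOrbit h (t + t₀) := by
    intro t
    apply oscCoord_injOn (H.mem_oval t).1 (explicitOrbit_fst_neg hh _)
    obtain ⟨h1, h2⟩ := harmonic_solution H.hasDerivAt_oscCoord_fst H.hasDerivAt_oscCoord_snd t
    rw [← ht₀, oscCoord_explicitOrbit hh] at h1 h2
    rw [oscCoord_explicitOrbit hh, Real.cos_add, Real.sin_add]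
    ext
    · simp only at h1 ⊢
      rw [h1]; ring
    · simp only at h2 ⊢
      rw [h2]; ring
  refine ⟨le_antisymm ?_ ?_, t₀, key⟩
  -- A period longer than `2π` would contradict injectivity on `[0, T)`; a shorter one would force
  -- `cos T = 1` with `0 < T < 2π`.
  · by_contra! hT
    have e : γ 0 = γ (2 * Real.pi) := by
      rw [key, key, add_comm (2 * Real.pi), explicitOrbit_periodic h, zero_add]
    have := H.bijOn.injOn ⟨le_rfl, H.period_pos⟩ ⟨Real.two_pi_pos.le, hT⟩ e
    exact Real.two_pi_pos.ne this
  · by_contra! hT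
    have e : γ T = γ 0 := by simpa using H.periodic 0
    rw [key, key, explicitOrbit_eq_iff hh, zero_add, Real.cos_add, Real.sin_add] at e
    have hsc := Real.sin_sq_add_cos_sq t₀
    have hc : Real.cos T = 1 := by
      linear_combination Real.cos t₀ * e.1 + Real.sin t₀ * e.2 + (1 - Real.cos T) * hsc
    have := (Real.cos_eq_one_iff_of_lt_of_lt (by linarith [H.period_pos, Real.pi_pos]) hT).1 hc
    exact H.period_pos.ne' this

/-! ### Moments of the orbit and their recurrence. -/

/-- The integral of the `i`-th power of minus the abscissa over one period of the orbit. -/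
noncomputable def powIntegral (A B : ℝ) (i : ℤ) : ℝ :=
  ∫ t in (0 : ℝ)..(2 * Real.pi), absc A B t ^ i

theorem continuous_absc_zpow {A B : ℝ} (hB : 0 < B) (hAB : B < A) (i : ℤ) :
    Continuous (fun t => absc A B t ^ i) :=
  (continuous_absc hB hAB).zpow₀ i fun t => Or.inl (absc_pos hB hAB t).ne'

theorem intervalIntegrable_absc_zpow {A B : ℝ} (hB : 0 < B) (hAB : B < A) (i : ℤ) (a b : ℝ) :
    IntervalIntegrable (fun t => absc A B t ^ i) MeasureTheory.volume a b :=
  (continuous_absc_zpow hB hAB i).intervalIntegrable a b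

theorem amp_mul_cos {A B : ℝ} (hB : 0 < B) (hAB : B < A) (t : ℝ) :
    B * Real.cos t * absc A B t ^ 2 = A * absc A B t ^ 2 - 1 := by
  have hps := recipSq_mul_absc_sq hB hAB t
  unfold recipSq at hps
  linarith

theorem amp_mul_sin_sq {A B : ℝ} (hB : 0 < B) (hAB : B < A) (hsq : B ^ 2 = A ^ 2 - 1) (t : ℝ) :
    (B * Real.sin t) ^ 2 * absc A B t ^ 4 = -absc A B t ^ 4 + 2 * A * absc A B t ^ 2 - 1 := by
  have h1 : (B * Real.sin t) ^ 2 * absc A B t ^ 4 =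
      B ^ 2 * absc A B t ^ 4 - (B * Real.cos t * absc A B t ^ 2) ^ 2 := by
    linear_combination (B ^ 2 * absc A B t ^ 4) * Real.sin_sq_add_cos_sq t
  rw [h1, amp_mul_cos hB hAB, hsq]
  ring

/-- The periodic function `2B sin t · s^i` has a derivative of mean zero. That derivative is a
combination of powers of `s`, because both `B cos t · s²` and `(B sin t)² s⁴` are polynomials in
`s²`. -/
theorem powIntegral_recurrence {A B : ℝ} (hB : 0 < B) (hAB : B < A) (hsq : B ^ 2 = A ^ 2 - 1)
    (i : ℤ) :
    i * powIntegral A B (i + 2) =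
      2 * (i - 1) * A * powIntegral A B i - (i - 2) * powIntegral A B (i - 2) := by
  have hd : ∀ t, HasDerivAt (fun t => 2 * (B * Real.sin t) * absc A B t ^ i)
      (i * absc A B t ^ (i + 2) - 2 * (i - 1) * A * absc A B t ^ i
        + (i - 2) * absc A B t ^ (i - 2)) t := by
    intro t
    have hs := absc_pos hB hAB t
    have h1 := (hasDerivAt_zpow i _ (Or.inl hs.ne')).comp t (hasDerivAt_absc hB hAB t)
    refine ((((Real.hasDerivAt_sin t).const_mul B).const_mul 2).mul h1).congr_deriv ?_
    have hc := amp_mul_cos hB hAB t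
    have hr := amp_mul_sin_sq hB hAB hsq t
    simp only [Function.comp_apply]
    rw [zpow_add₀ hs.ne', zpow_sub₀ hs.ne', zpow_sub₀ hs.ne']
    generalize absc A B t = s at *
    generalize s ^ i = z
    simp only [zpow_ofNat]
    field_simp
    linear_combination (2 * z) * hc - i * z * hr
  have key := intervalIntegral.integral_eq_sub_of_hasDerivAt (a := 0) (b := 2 * Real.pi)
    (fun t _ => hd t) ?_
  · have i1 := intervalIntegrable_absc_zpow hB hAB (i + 2) 0 (2 * Real.pi)
    have i2 := intervalIntegrable_absc_zpow hB hAB i 0 (2 * Real.pi)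
    have i3 := intervalIntegrable_absc_zpow hB hAB (i - 2) 0 (2 * Real.pi)
    rw [intervalIntegral.integral_add ((i1.const_mul _).sub (i2.const_mul _)) (i3.const_mul _),
      intervalIntegral.integral_sub (i1.const_mul _) (i2.const_mul _),
      intervalIntegral.integral_const_mul, intervalIntegral.integral_const_mul,
      intervalIntegral.integral_const_mul] at key
    simp only [Real.sin_two_pi, Real.sin_zero, mul_zero, zero_mul, sub_zero] at key
    unfold powIntegral
    linarith
  · apply Continuous.intervalIntegrable
    have c1 := continuous_absc_zpow hB hAB (i + 2)
    have c2 := continuous_absc_zpow hB hAB i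
    have c3 := continuous_absc_zpow hB hAB (i - 2)
    fun_prop

theorem powIntegral_zero (A B : ℝ) : powIntegral A B 0 = 2 * Real.pi := by
  simp [powIntegral]

theorem powIntegral_neg_two {A B : ℝ} (hB : 0 < B) (hAB : B < A) :
    powIntegral A B (-2) = 2 * Real.pi * A := by
  have h1 : ∀ t, absc A B t ^ (-2 : ℤ) = A - B * Real.cos t := by
    intro t
    have hs := absc_pos hB hAB t
    have := recipSq_mul_absc_sq hB hAB t
    unfold recipSq at this
    rw [zpow_neg, zpow_ofNat]
    field_simp
    linarith
  unfold powIntegral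
  simp only [h1]
  rw [intervalIntegral.integral_sub (by simp) (by
    apply Continuous.intervalIntegrable; fun_prop)]
  simp

theorem powIntegral_two {A B : ℝ} (hB : 0 < B) (hAB : B < A) (hsq : B ^ 2 = A ^ 2 - 1) :
    powIntegral A B 2 = 2 * Real.pi := by
  -- This is the half-angle primitive of `1/(A - B cos t)` for `A² - B² = 1`, written as `t` plus a
  -- periodic term so that it is smooth on the whole line.
  have hd : ∀ t, HasDerivAt
      (fun t => t + 2 * Real.arctan (B * Real.sin t / (A + 1 - B * Real.cos t)))
      (absc A B t ^ (2 : ℤ)) t := by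
    intro t
    have hp := recipSq_pos hB hAB t
    have hps := recipSq_mul_absc_sq hB hAB t
    have hsc := Real.sin_sq_add_cos_sq t
    have hA : 0 < A := hB.trans hAB
    unfold recipSq at hps hp
    have hD : 0 < A + 1 - B * Real.cos t := by linarith
    have h1 := (((Real.hasDerivAt_sin t).const_mul B).div
      (((Real.hasDerivAt_cos t).const_mul B).const_sub (A + 1)) hD.ne').arctan
    refine ((hasDerivAt_id t).add (h1.const_mul 2)).congr_deriv ?_
    have e : absc A B t ^ (2 : ℤ) = 1 / (A - B * Real.cos t) := by
      rw [zpow_ofNat, eq_div_iff hp.ne']; linarith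
    have e2 : 1 + (B * Real.sin t / (A + 1 - B * Real.cos t)) ^ 2 =
        2 * (A + 1) * (A - B * Real.cos t) / (A + 1 - B * Real.cos t) ^ 2 := by
      field_simp
      linear_combination B ^ 2 * hsc + hsq
    simp only [Pi.div_apply]
    rw [e, e2]
    field_simp
    linear_combination -B ^ 2 * hsc - hsq
  have key := intervalIntegral.integral_eq_sub_of_hasDerivAt (a := 0) (b := 2 * Real.pi)
    (fun t _ => hd t) (intervalIntegrable_absc_zpow hB hAB 2 _ _)
  rw [powIntegral, key]
  simp

/-! ### Reduction to complete elliptic integrals. -/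

theorem integral_comp_cos {f : ℝ → ℝ} (hf : Continuous fun t => f (Real.cos t)) :
    ∫ t in (0 : ℝ)..(2 * Real.pi), f (Real.cos t) =
      4 * ∫ θ in (0 : ℝ)..(Real.pi / 2), f (-Real.cos (2 * θ)) := by
  have h1 : ∫ t in Real.pi..(2 * Real.pi), f (Real.cos t) =
      ∫ t in (0 : ℝ)..Real.pi, f (Real.cos t) := by
    have := intervalIntegral.integral_comp_sub_left (a := 0) (b := Real.pi)
      (fun t => f (Real.cos t)) (2 * Real.pi)
    simp only [Real.cos_two_pi_sub, sub_zero] at this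
    rw [this]
    congr 1
    ring
  have h2 : ∫ t in (0 : ℝ)..Real.pi, f (Real.cos t) =
      2 * ∫ θ in (0 : ℝ)..(Real.pi / 2), f (-Real.cos (2 * θ)) := by
    -- The substitution `t = π - 2θ` turns `A - B cos t` into `A + B cos 2θ = (1 - k² sin² θ)/u²`,
    -- the Legendre form.
    have := intervalIntegral.integral_comp_sub_mul (a := 0) (b := Real.pi / 2)
      (fun t => f (Real.cos t)) (two_ne_zero) Real.pi
    simp only [Real.cos_pi_sub] at this
    rw [this, smul_eq_mul, mul_inv_cancel_left₀ two_ne_zero]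
    congr 1 <;> ring
  rw [← intervalIntegral.integral_add_adjacent_intervals (b := Real.pi)
    (hf.intervalIntegrable _ _) (hf.intervalIntegrable _ _), h1, h2]
  ring

/-- The mean squared abscissa of the oval in terms of its inner abscissa `u`. -/
noncomputable def meanOf (u : ℝ) : ℝ := (u ^ 4 + 1) / (2 * u ^ 2)

/-- The amplitude of the squared abscissa of the oval in terms of its inner abscissa `u`. -/
noncomputable def ampOf (u : ℝ) : ℝ := (1 - u ^ 4) / (2 * u ^ 2)

theorem ampOf_pos {u : ℝ} (hu : u ∈ Set.Ioo (0 : ℝ) 1) : 0 < ampOf u := by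
  have h0 := hu.1
  have : u ^ 4 < 1 := pow_lt_one₀ h0.le hu.2 (by norm_num)
  exact div_pos (by linarith) (by positivity)

theorem ampOf_lt {u : ℝ} (hu : u ∈ Set.Ioo (0 : ℝ) 1) : ampOf u < meanOf u := by
  have h0 := hu.1
  unfold ampOf meanOf
  gcongr
  have : 0 < u ^ 4 := by positivity
  linarith

theorem ampOf_sq {u : ℝ} (hu : u ∈ Set.Ioo (0 : ℝ) 1) : ampOf u ^ 2 = meanOf u ^ 2 - 1 := by
  have h0 := hu.1
  unfold ampOf meanOf
  field_simp
  ring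

theorem sqrt_recipSq_eq {u : ℝ} (hu : u ∈ Set.Ioo (0 : ℝ) 1) (θ : ℝ) :
    √(meanOf u - ampOf u * -Real.cos (2 * θ)) =
      √(1 - modulus u ^ 2 * Real.sin θ ^ 2) / u := by
  have h0 := hu.1
  have h4 : u ^ 4 ≤ 1 := pow_le_one₀ h0.le hu.2.le
  rw [modulus, Real.sq_sqrt (by linarith), Real.cos_two_mul, Real.cos_sq']
  have : meanOf u - ampOf u * -(2 * (1 - Real.sin θ ^ 2) - 1) =
      (1 - (1 - u ^ 4) * Real.sin θ ^ 2) / u ^ 2 := by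
    unfold meanOf ampOf
    field_simp
    ring
  rw [this, Real.sqrt_div' _ (by positivity), Real.sqrt_sq h0.le]

theorem powIntegral_one {u : ℝ} (hu : u ∈ Set.Ioo (0 : ℝ) 1) :
    powIntegral (meanOf u) (ampOf u) 1 = 4 * u * ellipticK (modulus u) := by
  have h := integral_comp_cos (f := fun c => (1 / √(meanOf u - ampOf u * c)) ^ (1 : ℤ))
    (continuous_absc_zpow (ampOf_pos hu) (ampOf_lt hu) 1)
  rw [powIntegral]
  refine h.trans ?_
  rw [mul_assoc]
  refine congrArg (4 * ·) ?_
  rw [ellipticK, ← intervalIntegral.integral_const_mul]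
  refine intervalIntegral.integral_congr fun θ _ => ?_
  simp only [sqrt_recipSq_eq hu, zpow_one]
  rw [one_div_div, mul_one_div]

theorem powIntegral_neg_one {u : ℝ} (hu : u ∈ Set.Ioo (0 : ℝ) 1) :
    powIntegral (meanOf u) (ampOf u) (-1) = 4 * ellipticE (modulus u) / u := by
  have h := integral_comp_cos (f := fun c => (1 / √(meanOf u - ampOf u * c)) ^ (-1 : ℤ))
    (continuous_absc_zpow (ampOf_pos hu) (ampOf_lt hu) (-1))
  rw [powIntegral]
  refine h.trans ?_
  rw [mul_div_assoc]
  refine congrArg (4 * ·) ?_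
  rw [ellipticE, ← intervalIntegral.integral_div]
  refine intervalIntegral.integral_congr fun θ _ => ?_
  simp only [sqrt_recipSq_eq hu, zpow_neg_one, one_div, inv_inv]

theorem lineIntegral_eq {h : ℝ} (hh : 0 < h) {γ : ℝ → ℝ × ℝ} {T : ℝ} (H : IsOrbitParam h γ T)
    (i : ℕ) :
    lineIntegral γ T i 1 = (-1) ^ (i + 1) / 4 *
      (2 * ovalMean h * powIntegral (ovalMean h) (ovalAmp h) i
        - powIntegral (ovalMean h) (ovalAmp h) (i + 2)
        - powIntegral (ovalMean h) (ovalAmp h) (i - 2)) := by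
  obtain ⟨rfl, t₀, hγ⟩ := H.eq_explicitOrbit hh
  have hB := ovalAmp_pos hh
  have hAB := ovalAmp_lt hh
  have hsq := ovalAmp_sq hh
  set A := ovalMean h with hA
  set B := ovalAmp h with hB'
  -- Substituting `x' = xy(1 - x)` makes the integrand `-x^(i+2) r²/4`. With `x = -s`, the factor
  -- `r² s⁴` is then the quadratic in `s²` from `amp_mul_sin_sq`.
  let g : ℝ → ℝ := fun t => (-1) ^ (i + 1) / 4 *
    (2 * A * absc A B t ^ (i : ℤ) - absc A B t ^ ((i : ℤ) + 2) - absc A B t ^ ((i : ℤ) - 2))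
  have hint : ∀ t, ((γ t).1 - 1) * (γ t).1 ^ ((i : ℤ) - 3) * (γ t).2 ^ 1 *
      deriv (fun s => (γ s).1) t = g (t + t₀) := by
    intro t
    rw [(H.hasDerivAt_fst t).deriv, hγ t]
    simp only [explicitOrbit, ← hA, ← hB', g]
    generalize t + t₀ = t'
    have hs := absc_pos hB hAB t'
    have hr := amp_mul_sin_sq hB hAB hsq t'
    generalize absc A B t' = s at *
    generalize B * Real.sin t' = r at *
    rw [zpow_sub₀ (neg_ne_zero.2 hs.ne'), zpow_add₀ hs.ne', zpow_sub₀ hs.ne']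
    simp only [zpow_natCast, zpow_ofNat, pow_one]
    rw [neg_pow s i, pow_succ (-1 : ℝ) i]
    generalize s ^ i = z
    generalize (-1 : ℝ) ^ i = w
    field_simp
    linear_combination (-4 * w * z * (1 + s) ^ 2) * hr
  have hper : Function.Periodic g (2 * Real.pi) := by
    intro t
    simp only [g, absc_add_two_pi]
  unfold lineIntegral
  rw [intervalIntegral.integral_congr (fun t _ => hint t),
    intervalIntegral.integral_comp_add_right (fun t => g t), zero_add, add_comm (2 * Real.pi),
    hper.intervalIntegral_add_eq t₀ 0, zero_add]
  have i1 := intervalIntegrable_absc_zpow hB hAB i 0 (2 * Real.pi)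
  have i2 := intervalIntegrable_absc_zpow hB hAB (i + 2) 0 (2 * Real.pi)
  have i3 := intervalIntegrable_absc_zpow hB hAB (i - 2) 0 (2 * Real.pi)
  simp only [g]
  rw [intervalIntegral.integral_const_mul,
    intervalIntegral.integral_sub ((i1.const_mul _).sub i2) i3,
    intervalIntegral.integral_sub (i1.const_mul _) i2, intervalIntegral.integral_const_mul]
  rfl

open Polynomial

/-! ### The change of variable from `h` to `u`. -/

theorem uVar_sq {h : ℝ} (hh : 0 < h) : uVar h ^ 2 = ovalMean h - ovalAmp h := by
  have := ovalAmp_lt hh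
  unfold ovalMean ovalAmp at *
  rw [uVar, Real.sq_sqrt (by linarith)]

theorem uVar_mem {h : ℝ} (hh : 0 < h) : uVar h ∈ Set.Ioo (0 : ℝ) 1 := by
  have h1 := ovalAmp_lt hh
  have h2 := ovalAmp_sq hh
  have h3 := ovalAmp_pos hh
  have h4 := uVar_sq hh
  have h0 : 0 ≤ uVar h := Real.sqrt_nonneg _
  have hA : 1 < ovalMean h := by unfold ovalMean; linarith
  constructor
  · refine lt_of_le_of_ne h0 fun h => ?_
    rw [← h] at h4
    linarith
  · nlinarith

theorem meanOf_uVar {h : ℝ} (hh : 0 < h) : meanOf (uVar h) = ovalMean h := by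
  have h2 := ovalAmp_sq hh
  have h4 := uVar_sq hh
  have h0 := (uVar_mem hh).1
  rw [meanOf, div_eq_iff (by positivity)]
  linear_combination (uVar h ^ 2 - ovalMean h - ovalAmp h) * h4 + h2

theorem ampOf_uVar {h : ℝ} (hh : 0 < h) : ampOf (uVar h) = ovalAmp h := by
  have h2 := ovalAmp_sq hh
  have h4 := uVar_sq hh
  have h0 := (uVar_mem hh).1
  rw [ampOf, div_eq_iff (by positivity)]
  linear_combination (-uVar h ^ 2 - ovalMean h - ovalAmp h) * h4 + h2

theorem bijOn_uVar : Set.BijOn uVar (Set.Ioi 0) (Set.Ioo 0 1) := by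
  refine ⟨fun h hh => uVar_mem hh, ?_, ?_⟩
  · intro h hh h' hh' e
    have := meanOf_uVar hh
    rw [e, meanOf_uVar hh'] at this
    unfold ovalMean at this
    linarith
  · intro u hu
    have h0 := hu.1
    have hB := ampOf_pos hu
    have hsq := ampOf_sq hu
    have hA : 1 < meanOf u := by nlinarith [ampOf_lt hu]
    refine ⟨(meanOf u - 1) / 8, by simpa using hA, ?_⟩
    have e : 4 * √(4 * ((meanOf u - 1) / 8) ^ 2 + (meanOf u - 1) / 8) = ampOf u := by
      rw [show 4 * ((meanOf u - 1) / 8) ^ 2 + (meanOf u - 1) / 8 = (ampOf u / 4) ^ 2 by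
        linear_combination (-1 / 16) * hsq, Real.sqrt_sq (by positivity)]
      ring
    rw [uVar, e, show 8 * ((meanOf u - 1) / 8) + 1 - ampOf u = u ^ 2 by
      unfold meanOf ampOf; field_simp; ring, Real.sqrt_sq h0.le]

/-! ### Polynomial coefficients and their degrees. -/

/-- `u ^ k * f u` is a combination of `F u` and `G u` on `(0, 1)` whose coefficients are polynomials
in `u ^ 4` of degree at most `d`. -/
def QuarticForm (F G : ℝ → ℝ) (d k : ℕ) (f : ℝ → ℝ) : Prop :=
  ∃ α β : ℝ[X], α.natDegree ≤ d ∧ β.natDegree ≤ d ∧ ∀ u ∈ Set.Ioo (0 : ℝ) 1,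
    u ^ k * f u = α.eval (u ^ 4) * F u + β.eval (u ^ 4) * G u

/-- Both the moment recurrence and the line integrals have the shape `b A g + c f`. After
multiplication by `u^(k+4)`, the factor `u²A = (u⁴ + 1)/2` goes with `g` and `u⁴` with `f`. -/
theorem QuarticForm.comb {F G : ℝ → ℝ} {d k : ℕ} {f g h : ℝ → ℝ} (hf : QuarticForm F G d k f)
    (hg : QuarticForm F G (d + 1) (k + 2) g) (b c : ℝ)
    (hh : ∀ u ∈ Set.Ioo (0 : ℝ) 1, h u = b * meanOf u * g u + c * f u) :
    QuarticForm F G (d + 2) (k + 4) h := by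
  obtain ⟨α, β, hα, hβ, e⟩ := hf
  obtain ⟨α', β', hα', hβ', e'⟩ := hg
  have hdeg : ∀ p q : ℝ[X], p.natDegree ≤ d → q.natDegree ≤ d + 1 →
      (C (b / 2) * (X + 1) * q + C c * X * p).natDegree ≤ d + 2 := by
    intro p q hp hq
    refine natDegree_add_le_of_degree_le (natDegree_mul_le_of_le (m := 1) ?_ hq |>.trans ?_)
      (natDegree_mul_le_of_le (m := 1) ?_ hp |>.trans ?_)
    · compute_degree
    · omega
    · compute_degree
    · omega
  refine ⟨C (b / 2) * (X + 1) * α' + C c * X * α, C (b / 2) * (X + 1) * β' + C c * X * β,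
    hdeg _ _ hα hα', hdeg _ _ hβ hβ', fun u hu => ?_⟩
  have h0 := hu.1
  have hm : 2 * (meanOf u * u ^ 2) = u ^ 4 + 1 := by unfold meanOf; field_simp
  rw [hh u hu]
  simp only [eval_add, eval_mul, eval_C, eval_X, eval_one]
  have e1 := e u hu
  have e2 := e' u hu
  rw [pow_add] at e2 ⊢
  linear_combination b * u ^ k * u ^ 2 * g u / 2 * hm + b / 2 * (u ^ 4 + 1) * e2 + c * u ^ 4 * e1

/-- `powIntegral` as a function of the inner abscissa of the oval. -/
noncomputable def moment (i : ℤ) (u : ℝ) : ℝ := powIntegral (meanOf u) (ampOf u) i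

theorem moment_recurrence (i : ℤ) {u : ℝ} (hu : u ∈ Set.Ioo (0 : ℝ) 1) :
    i * moment (i + 2) u =
      2 * (i - 1) * meanOf u * moment i u - (i - 2) * moment (i - 2) u :=
  powIntegral_recurrence (ampOf_pos hu) (ampOf_lt hu) (ampOf_sq hu) i

/-- The two parity chains are `j = 0` and `j = 1`. They start at `J_2` and `J_3`, the first moments
from which the degree grows regularly. -/
theorem quarticForm_moment {F G : ℝ → ℝ} {j : ℕ} (h0 : QuarticForm F G 0 j (moment (j + 2)))
    (h1 : QuarticForm F G 1 (j + 2) (moment (j + 4))) (m : ℕ) :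
    QuarticForm F G m (2 * m + j) (moment ((2 * m + j + 2 : ℕ) : ℤ)) := by
  induction m using Nat.twoStepInduction with
  | zero => simpa using h0
  | one =>
    rw [show 2 * 1 + j = j + 2 by ring]
    exact_mod_cast h1
  | more m ih0 ih1 =>
    have hk : 2 * (m + 1) + j = 2 * m + j + 2 := by ring
    rw [hk] at ih1
    have hi : (2 * (m : ℝ) + j + 4) ≠ 0 := by positivity
    have := ih0.comb ih1 (h := moment ((2 * (m + 2) + j + 2 : ℕ) : ℤ))
      (2 * (2 * m + j + 3) / (2 * m + j + 4)) (-(2 * m + j + 2) / (2 * m + j + 4)) ?_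
    · convert this using 1
      ring
    · intro u hu
      have r := moment_recurrence ((2 * m + j + 4 : ℕ) : ℤ) hu
      rw [show ((2 * m + j + 4 : ℕ) : ℤ) + 2 = ((2 * (m + 2) + j + 2 : ℕ) : ℤ) by push_cast; ring,
        show ((2 * m + j + 4 : ℕ) : ℤ) - 2 = ((2 * m + j + 2 : ℕ) : ℤ) by push_cast; ring] at r
      rw [show 2 * m + j + 2 + 2 = 2 * m + j + 4 by ring]
      push_cast at r ⊢
      field_simp
      linear_combination r

theorem moment_three {u : ℝ} (hu : u ∈ Set.Ioo (0 : ℝ) 1) :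
    moment 3 u = 4 * ellipticE (modulus u) / u := by
  have := moment_recurrence 1 hu
  norm_num at this
  rw [this]
  exact powIntegral_neg_one hu

theorem quarticForm_moment_odd (m : ℕ) :
    QuarticForm (fun u => ellipticE (modulus u)) (fun u => ellipticK (modulus u))
      m (2 * m + 1) (moment ((2 * m + 3 : ℕ) : ℤ)) := by
  refine quarticForm_moment (j := 1) ?_ ?_ m
  · refine ⟨C 4, 0, by simp, by simp, fun u hu => ?_⟩
    have h0 := hu.1
    rw [show ((1 : ℕ) : ℤ) + 2 = 3 by norm_num, moment_three hu]
    simp only [eval_C, eval_zero]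
    field_simp
    ring
  · refine ⟨C (8 / 3) * (X + 1), C (-4 / 3) * X, by compute_degree, by compute_degree,
      fun u hu => ?_⟩
    have h0 := hu.1
    have r := moment_recurrence 3 hu
    rw [show ((1 : ℕ) : ℤ) + 4 = 3 + 2 by norm_num]
    norm_num at r
    rw [moment_three hu, show moment 1 u = _ from powIntegral_one hu] at r
    have : moment (3 + 2) u = (4 * meanOf u * (4 * ellipticE (modulus u) / u) -
        4 * u * ellipticK (modulus u)) / 3 := by
      rw [← r]; norm_num
    rw [this]
    simp only [eval_mul, eval_add, eval_C, eval_X, eval_one, meanOf]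
    field_simp
    ring

theorem moment_two {u : ℝ} (hu : u ∈ Set.Ioo (0 : ℝ) 1) : moment 2 u = 2 * Real.pi :=
  powIntegral_two (ampOf_pos hu) (ampOf_lt hu) (ampOf_sq hu)

theorem quarticForm_moment_even (m : ℕ) :
    QuarticForm (fun _ => 1) (fun _ => 0) m (2 * m) (moment ((2 * m + 2 : ℕ) : ℤ)) := by
  refine quarticForm_moment (j := 0) ?_ ?_ m
  · refine ⟨C (2 * Real.pi), 0, (natDegree_C _).le, by simp, fun u hu => ?_⟩
    rw [show ((0 : ℕ) : ℤ) + 2 = 2 by norm_num, moment_two hu]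
    simp
  · refine ⟨C Real.pi * (X + 1), 0, by compute_degree, by simp, fun u hu => ?_⟩
    have h0 := hu.1
    have r := moment_recurrence 2 hu
    norm_num [moment_two hu] at r
    rw [show ((0 : ℕ) : ℤ) + 4 = 4 by norm_num]
    have : moment 4 u = meanOf u * (2 * Real.pi) := by linarith
    rw [this]
    simp only [eval_mul, eval_add, eval_C, eval_X, eval_one, meanOf]
    field_simp
    ring

/-- The line integral of order `i` as a function of the inner abscissa of the oval. -/
noncomputable def lineMoment (i : ℕ) (u : ℝ) : ℝ :=
  (-1) ^ (i + 1) / 4 * (2 * meanOf u * moment i u - moment (i + 2) u - moment (i - 2) u)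

theorem lineIntegral_eq_lineMoment {h : ℝ} (hh : 0 < h) {γ : ℝ → ℝ × ℝ} {T : ℝ}
    (H : IsOrbitParam h γ T) (i : ℕ) : lineIntegral γ T i 1 = lineMoment i (uVar h) := by
  rw [lineIntegral_eq hh H, lineMoment, moment, moment, moment, meanOf_uVar hh, ampOf_uVar hh]

/-- The recurrence eliminates `J_{i+2}`, leaving two consecutive moments of one parity, the shape
required by `QuarticForm.comb`. -/
theorem lineMoment_eq {i : ℕ} (hi : i ≠ 0) {u : ℝ} (hu : u ∈ Set.Ioo (0 : ℝ) 1) :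
    lineMoment i u = (-1) ^ (i + 1) / (2 * i) * (meanOf u * moment i u - moment (i - 2) u) := by
  have r := moment_recurrence i hu
  have hi' : (i : ℝ) ≠ 0 := by exact_mod_cast hi
  rw [lineMoment]
  push_cast at r
  field_simp
  linear_combination (-2) * r

theorem QuarticForm.lineMoment {F G : ℝ → ℝ} {d k : ℕ}
    (h0 : QuarticForm F G d k (moment ((k + 2 : ℕ) : ℤ)))
    (h1 : QuarticForm F G (d + 1) (k + 2) (moment ((k + 4 : ℕ) : ℤ))) :
    QuarticForm F G (d + 2) (k + 4) (lineMoment (k + 4)) := by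
  refine h0.comb h1 ((-1) ^ (k + 4 + 1) / (2 * (k + 4 : ℕ)))
    (-((-1) ^ (k + 4 + 1) / (2 * (k + 4 : ℕ)))) fun u hu => ?_
  rw [lineMoment_eq (by omega) hu,
    show ((k + 4 : ℕ) : ℤ) - 2 = ((k + 2 : ℕ) : ℤ) by push_cast; ring]
  ring

theorem lineMoment_even {i : ℕ} (hi : Even i) : ∃ ρ : ℝ[X], ρ.natDegree ≤ max i 2 ∧
    ∀ u ∈ Set.Ioo (0 : ℝ) 1, u ^ max i 2 * lineMoment i u = ρ.eval (u ^ 2) := by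
  -- Orders `0` and `2` give the same function. It needs the factor `u²`, which is why the exponent
  -- is `max i 2`.
  have small : ∀ i, (∀ u ∈ Set.Ioo (0 : ℝ) 1, lineMoment i u = -(Real.pi / 2) * (meanOf u - 1)) →
      max i 2 = 2 → ∃ ρ : ℝ[X], ρ.natDegree ≤ max i 2 ∧
        ∀ u ∈ Set.Ioo (0 : ℝ) 1, u ^ max i 2 * lineMoment i u = ρ.eval (u ^ 2) := by
    intro i h hi
    rw [hi]
    refine ⟨C (-(Real.pi / 4)) * (X ^ 2 + 1 - C 2 * X), by compute_degree, fun u hu => ?_⟩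
    have h0 := hu.1
    rw [h u hu, meanOf]
    simp only [eval_mul, eval_add, eval_sub, eval_pow, eval_C, eval_X, eval_one]
    field_simp
    ring
  obtain ⟨m, rfl⟩ := hi.two_dvd
  match m with
  | 0 =>
    refine small _ (fun u hu => ?_) (by simp)
    have h2 : moment (-2) u = 2 * Real.pi * meanOf u :=
      powIntegral_neg_two (ampOf_pos hu) (ampOf_lt hu)
    have h0 : moment 0 u = 2 * Real.pi := powIntegral_zero _ _
    norm_num [lineMoment, moment_two hu, h2, h0]
    ring
  | 1 =>
    refine small _ (fun u hu => ?_) (by simp)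
    have h0 : moment 0 u = 2 * Real.pi := powIntegral_zero _ _
    rw [lineMoment_eq (by norm_num) hu]
    norm_num [moment_two hu, h0]
    ring
  | m + 2 =>
    obtain ⟨α, β, hα, -, e⟩ :=
      QuarticForm.lineMoment (quarticForm_moment_even m) (quarticForm_moment_even (m + 1))
    refine ⟨α.comp (X ^ 2), ?_, fun u hu => ?_⟩
    · rw [natDegree_comp, natDegree_X_pow]
      omega
    · have := e u hu
      rw [show max (2 * (m + 2)) 2 = 2 * m + 4 by omega, show 2 * (m + 2) = 2 * m + 4 by ring,
        this, eval_comp, eval_pow, eval_X, ← pow_mul]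
      simp

theorem lineMoment_odd {i : ℕ} (hi : Odd i) : ∃ α β : ℝ[X], α.natDegree ≤ (i - 1) / 2 ∧
    β.natDegree ≤ max ((i - 1) / 2) 1 ∧ ∀ u ∈ Set.Ioo (0 : ℝ) 1, u ^ i * lineMoment i u =
      α.eval (u ^ 4) * ellipticE (modulus u) + β.eval (u ^ 4) * ellipticK (modulus u) := by
  obtain ⟨m, rfl⟩ := hi
  match m with
  | 0 =>
    -- Order `1` is exceptional: the term `A J_1` already gives `K` a coefficient of degree one in
    -- `u⁴`, hence the `max` with `1` in the bound.
    refine ⟨C (-2), X + 1, by simp, by compute_degree; simp, fun u hu => ?_⟩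
    have h0 := hu.1
    have h1 : moment 1 u = _ := powIntegral_one hu
    have h2 : moment (-1) u = _ := powIntegral_neg_one hu
    rw [lineMoment_eq (by norm_num) hu]
    norm_num [h1, h2, meanOf]
    field_simp
    ring
  | 1 =>
    refine ⟨C (1 / 3) * (X + 1), C (-2 / 3) * X, by norm_num; compute_degree,
      by norm_num, fun u hu => ?_⟩
    have h0 := hu.1
    have h1 : moment 1 u = _ := powIntegral_one hu
    rw [lineMoment_eq (by norm_num) hu]
    norm_num [h1, moment_three hu, meanOf]
    field_simp
    ring
  | m + 2 =>
    obtain ⟨α, β, hα, hβ, e⟩ :=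
      QuarticForm.lineMoment (quarticForm_moment_odd m) (quarticForm_moment_odd (m + 1))
    refine ⟨α, β, by omega, by omega, fun u hu => ?_⟩
    rw [show 2 * (m + 2) + 1 = 2 * m + 1 + 4 by ring]
    exact e u hu

/-! ### Assembling the sum over a common denominator. -/

/-- `u ^ n * f u` is a combination of `1`, `K` and `E` on `(0, 1)` with polynomial coefficients, of
the parities that correspond to `n` and with the given degree bounds. -/
def EllipticForm (n dP dQ dR : ℕ) (f : ℝ → ℝ) : Prop :=
  ∃ P Q R : ℝ[X], P.natDegree ≤ dP ∧ Q.natDegree ≤ dQ ∧ R.natDegree ≤ dR ∧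
    ∀ u ∈ Set.Ioo (0 : ℝ) 1, u ^ n * f u = u ^ (n % 2) * P.eval (u ^ 2)
      + Q.eval u * ellipticK (modulus u)
      + u ^ ((n + 1) % 2) * R.eval (u ^ 2) * ellipticE (modulus u)

theorem EllipticForm.sum {n dP dQ dR : ℕ} {ι : Type*} {s : Finset ι} {f : ι → ℝ → ℝ}
    (hf : ∀ i ∈ s, EllipticForm n dP dQ dR (f i)) (c : ι → ℝ) :
    EllipticForm n dP dQ dR (fun u => ∑ i ∈ s, c i * f i u) := by
  classical
  induction s using Finset.induction_on with
  | empty => exact ⟨0, 0, 0, by simp, by simp, by simp, by simp⟩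
  | insert i s hi ih =>
    obtain ⟨P, Q, R, hP, hQ, hR, e⟩ := ih fun j hj => hf j (Finset.mem_insert_of_mem hj)
    obtain ⟨P', Q', R', hP', hQ', hR', e'⟩ := hf i (Finset.mem_insert_self _ _)
    refine ⟨C (c i) * P' + P, C (c i) * Q' + Q, C (c i) * R' + R,
      natDegree_add_le_of_degree_le ((natDegree_C_mul_le _ _).trans hP') hP,
      natDegree_add_le_of_degree_le ((natDegree_C_mul_le _ _).trans hQ') hQ,
      natDegree_add_le_of_degree_le ((natDegree_C_mul_le _ _).trans hR') hR, fun u hu => ?_⟩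
    simp only [Finset.sum_insert hi, eval_add, eval_mul, eval_C]
    linear_combination c i * e' u hu + e u hu

/-- For odd `i` the coefficient of `K` has degree at most `n - i + 4 max((i - 1)/2, 1)`. The value
`n + 3` at `i = 1` and the bound `2n - 2` for `i ≥ 3` account for the two conditions on `dQ`. The
parity of `n - i` decides which of the other two terms carries an extra `u`. -/
theorem ellipticForm_lineMoment {n i dQ : ℕ} (hn : 3 ≤ n) (hi : i ≤ n) (hQ : n + 3 ≤ dQ)
    (hQ' : 2 * n ≤ dQ + 2) :
    EllipticForm n (2 * ((n - 2) / 2) + 2) dQ (2 * ((n - 3) / 2) + 2) (lineMoment i) := by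
  rcases Nat.even_or_odd i with he | ho
  · obtain ⟨ρ, hρ, e⟩ := lineMoment_even he
    have hi2 : max i 2 % 2 = 0 := by
      have := Nat.even_iff.1 he
      omega
    refine ⟨X ^ ((n - max i 2) / 2) * ρ, 0, 0, ?_, by simp, by simp, fun u hu => ?_⟩
    · refine (natDegree_mul_le_of_le (natDegree_X_pow_le _) hρ).trans ?_
      omega
    · simp only [eval_mul, eval_pow, eval_X, eval_zero, ← e u hu]
      rw [show u ^ n = u ^ (n % 2 + 2 * ((n - max i 2) / 2) + max i 2) by congr 1; omega]
      ring
  · obtain ⟨α, β, hα, hβ, e⟩ := lineMoment_odd ho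
    have hi2 := Nat.odd_iff.1 ho
    refine ⟨0, X ^ (n - i) * β.comp (X ^ 4), X ^ ((n - i) / 2) * α.comp (X ^ 2), by simp, ?_, ?_,
      fun u hu => ?_⟩
    · refine (natDegree_mul_le_of_le (natDegree_X_pow_le _) natDegree_comp_le).trans ?_
      rw [natDegree_X_pow]
      omega
    · refine (natDegree_mul_le_of_le (natDegree_X_pow_le _) natDegree_comp_le).trans ?_
      rw [natDegree_X_pow]
      omega
    · simp only [eval_mul, eval_pow, eval_X, eval_zero, eval_comp, ← pow_mul]
      have h1 : u ^ n = u ^ (n - i) * u ^ i := by rw [← pow_add]; congr 1; omega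
      have h2 : u ^ (n - i) = u ^ ((n + 1) % 2) * u ^ (2 * ((n - i) / 2)) := by
        rw [← pow_add]; congr 1; omega
      rw [h1, mul_assoc, e u hu]
      norm_num
      linear_combination α.eval (u ^ 4) * ellipticE (modulus u) * h2

theorem ellipticForm_abelianIntegral {n dQ : ℕ} (hn : 3 ≤ n) (hQ : n + 3 ≤ dQ)
    (hQ' : 2 * n ≤ dQ + 2) (a : ℕ → ℝ) : ∃ P Q R : ℝ[X],
      P.natDegree ≤ 2 * ((n - 2) / 2) + 2 ∧ Q.natDegree ≤ dQ ∧
      R.natDegree ≤ 2 * ((n - 3) / 2) + 2 ∧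
      ∀ h : ℝ, 0 < h → ∀ (γ : ℝ → ℝ × ℝ) (T : ℝ), IsOrbitParam h γ T →
        abelianIntegral n a γ T = 1 / uVar h ^ n *
          (uVar h ^ (n % 2) * P.eval (uVar h ^ 2)
            + Q.eval (uVar h) * ellipticK (modulus (uVar h))
            + uVar h ^ ((n + 1) % 2) * R.eval (uVar h ^ 2) * ellipticE (modulus (uVar h))) := by
  obtain ⟨P, Q, R, hP, hQ, hR, e⟩ := EllipticForm.sum (s := Finset.range (n + 1))
    (fun i hi => ellipticForm_lineMoment hn (Finset.mem_range_succ_iff.1 hi) hQ hQ')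
    (fun i => a i / 2)
  refine ⟨P, Q, R, hP, hQ, hR, fun h hh γ T H => ?_⟩
  have hu := uVar_mem hh
  have h0 := hu.1
  rw [← e _ hu, one_div, inv_mul_cancel_left₀ (by positivity), abelianIntegral, Finset.mul_sum]
  refine Finset.sum_congr rfl fun i _ => ?_
  rw [lineIntegral_eq_lineMoment hh H]
  ring

end CubicReversible

open CubicReversible in
theorem proposition2p1 (n : ℕ) (hn : 3 ≤ n) (a : ℕ → ℝ) :
    Set.BijOn uVar (Set.Ioi 0) (Set.Ioo 0 1) ∧
    (∀ h : ℝ, 0 < h → ∃ (γ : ℝ → ℝ × ℝ) (T : ℝ), IsOrbitParam h γ T) ∧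
    (Odd n → ∃ P Q R : Polynomial ℝ,
      P.natDegree ≤ 2 * ((n - 2) / 2) + 2 ∧
      Q.natDegree ≤ 4 * ((n - 3) / 2) + 6 ∧
      R.natDegree ≤ 2 * ((n - 3) / 2) + 2 ∧
      ∀ h : ℝ, 0 < h → ∀ (γ : ℝ → ℝ × ℝ) (T : ℝ), IsOrbitParam h γ T →
        abelianIntegral n a γ T =
          1 / uVar h ^ (2 * ((n - 3) / 2) + 3) *
            (uVar h * P.eval (uVar h ^ 2)
              + Q.eval (uVar h) * ellipticK (modulus (uVar h))
              + R.eval (uVar h ^ 2) * ellipticE (modulus (uVar h)))) ∧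
    (Even n → ∃ P Q R : Polynomial ℝ,
      P.natDegree ≤ 2 * ((n - 2) / 2) + 2 ∧
      Q.natDegree ≤ 4 * ((n - 3) / 2) + 7 ∧
      R.natDegree ≤ 2 * ((n - 3) / 2) + 2 ∧
      ∀ h : ℝ, 0 < h → ∀ (γ : ℝ → ℝ × ℝ) (T : ℝ), IsOrbitParam h γ T →
        abelianIntegral n a γ T =
          1 / uVar h ^ (2 * ((n - 2) / 2) + 2) *
            (P.eval (uVar h ^ 2)
              + Q.eval (uVar h) * ellipticK (modulus (uVar h))
              + uVar h * R.eval (uVar h ^ 2) * ellipticE (modulus (uVar h)))) := by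
  refine ⟨bijOn_uVar, fun h hh => ⟨_, _, isOrbitParam_explicitOrbit hh⟩, fun ho => ?_, fun he => ?_⟩
  · have h2 := Nat.odd_iff.1 ho
    obtain ⟨P, Q, R, hP, hQ, hR, e⟩ :=
      -- For odd `n` this bound equals `2n`, and `n + 3 ≤ 2n` is an equality at `n = 3`.
      ellipticForm_abelianIntegral (dQ := 4 * ((n - 3) / 2) + 6) hn (by omega) (by omega) a
    rw [show (n + 1) % 2 = 0 by omega, h2] at e
    simp only [pow_one, pow_zero, one_mul] at e
    rw [show 2 * ((n - 3) / 2) + 3 = n by omega]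
    exact ⟨P, Q, R, hP, hQ, hR, e⟩
  · have h2 := Nat.even_iff.1 he
    obtain ⟨P, Q, R, hP, hQ, hR, e⟩ :=
      -- For even `n` this bound equals `2n - 1`, and `n + 3 ≤ 2n - 1` is an equality at `n = 4`.
      ellipticForm_abelianIntegral (dQ := 4 * ((n - 3) / 2) + 7) hn (by omega) (by omega) a
    rw [show (n + 1) % 2 = 1 by omega, h2] at e
    simp only [pow_one, pow_zero, one_mul] at e
    have hn2 : 2 * ((n - 2) / 2) + 2 = n := by omega
    rw [hn2] at hP ⊢
    exact ⟨P, Q, R, hP, hQ, hR, e⟩
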